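/- Let $n\ge 1$, $A\in\mathbb R^{n\times n}$ and $b\in\mathbb R^n$, and consider the absolute value equation (AVE) $Ax-|x|=b$, where $|x|$ is the componentwise absolute value. For $x\in\mathbb R^n$ let $D(x)=\mathrm{diag}(\mathrm{sign}(x))$, where $\mathrm{sign}$ takes the values $1,0,-1$ componentwise. The generalized Newton method (GNM) started at $x^0\in\mathbb R^n$ is $x^{i+1}=(A-D(x^i))^{-1}b$, $i=0,1,\dots$; it is well defined if $A-D(x^i)$ is nonsingular for every $i\ge 0$. A real square matrix $M$ is a singular $M$-matrix if $M=sI-B$ with $B\ge 0$ entrywise and $s=\rho(B)$, the spectral radius of $B$. It is irreducible if there is no permutation matrix $P$ such that $P^TMP=\begin{pmatrix}M_{11}&M_{12}\\0&M_{22}\end{pmatrix}$ with nonempty square blocks $M_{11},M_{22}$. Theorem. Suppose that $A-I$ is an irreducible singular $M$-matrix, that $v\in\mathbb R^n$ satisfies $v>0$ (componentwise) and $(A^T-I)v=0$, and that $v^Tb=0$. Then every solution of the AVE is nonnegative, and exactly one solution $\hat x$ has one or more zero components. Moreover, for any $x^0\in\mathbb R^n$ with $D(x^0)\ne I$, the GNM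 is well defined and reaches $\hat x$ in at most $n+1$ iterations: there is $m\le n+1$ such that $x^i=\hat x$ for all $i\ge m$. -/

import Mathlib

open scoped Matrix

namespace AVE

/-- The spectral radius of a real square matrix: the largest modulus of its complex eigenvalues. -/
noncomputable def specRad {n : ℕ} (B : Matrix (Fin n) (Fin n) ℝ) : ℝ :=
  (spectralRadius ℂ (B.map Complex.ofReal)).toReal

/-- The extended-real spectral radius is finite, so `toReal` loses nothing in `specRad`. -/
theorem spectralRadius_ne_top {n : ℕ} (B : Matrix (Fin n) (Fin n) ℝ) :
    spectralRadius ℂ (B.map Complex.ofReal) ≠ ⊤ := by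
  have hfin : (spectrum ℂ (B.map Complex.ofReal)).Finite := Matrix.finite_spectrum _
  obtain ⟨C, hC⟩ := (hfin.image (fun k : ℂ => ‖k‖₊)).bddAbove
  refine ne_top_of_le_ne_top (ENNReal.coe_ne_top (r := C)) ?_
  refine iSup₂_le fun k hk => ?_
  exact ENNReal.coe_le_coe.2 (hC ⟨k, hk, rfl⟩)

/-- A singular `M`-matrix: `M = s I - B` with `B ≥ 0` entrywise and `s = ρ(B)`. -/
def IsSingularMMatrix {n : ℕ} (M : Matrix (Fin n) (Fin n) ℝ) : Prop :=
  ∃ (s : ℝ) (B : Matrix (Fin n) (Fin n) ℝ),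
    (∀ i j, 0 ≤ B i j) ∧ M = s • (1 : Matrix (Fin n) (Fin n) ℝ) - B ∧ s = specRad B

/-- A matrix is reducible if a simultaneous permutation of its rows and columns (`Pᵀ M P` with `P`
a permutation matrix) is block upper triangular, with square diagonal blocks of sizes `m` and
`n - m`, both nonempty. -/
def IsReducible {n : ℕ} (M : Matrix (Fin n) (Fin n) ℝ) : Prop :=
  ∃ (σ : Equiv.Perm (Fin n)) (m : ℕ), 0 < m ∧ m < n ∧
    ∀ i j : Fin n, m ≤ (i : ℕ) → (j : ℕ) < m → M.submatrix σ σ i j = 0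

/-- A matrix is irreducible if it is not reducible. -/
def IsIrreducible {n : ℕ} (M : Matrix (Fin n) (Fin n) ℝ) : Prop :=
  ¬ IsReducible M

/-- `x` solves the absolute value equation `A x - |x| = b`. -/
def IsSolution {n : ℕ} (A : Matrix (Fin n) (Fin n) ℝ) (b x : Fin n → ℝ) : Prop :=
  A *ᵥ x - (fun i => |x i|) = b

/-- `D(x) = diag(sign(x))`. -/
noncomputable def D {n : ℕ} (x : Fin n → ℝ) : Matrix (Fin n) (Fin n) ℝ :=
  Matrix.diagonal fun i => Real.sign (x i)

/-- The generalized Newton iterates `x^{k+1} = (A - D(x^k))⁻¹ b`. They are meaningful as long as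
`A - D(x^k)` is nonsingular. -/
noncomputable def gnm {n : ℕ} (A : Matrix (Fin n) (Fin n) ℝ) (b x₀ : Fin n → ℝ) :
    ℕ → Fin n → ℝ
  | 0 => x₀
  | k + 1 => (A - D (gnm A b x₀ k))⁻¹ *ᵥ b

/-- The generalized Newton method started at `x₀` is well defined: every matrix to be inverted is
nonsingular. -/
def GnmWellDefined {n : ℕ} (A : Matrix (Fin n) (Fin n) ℝ) (b x₀ : Fin n → ℝ) : Prop :=
  ∀ k : ℕ, IsUnit (A - D (gnm A b x₀ k))

end AVE

/-!
Write `M = A - 1`. It is an irreducible matrix with nonpositive off-diagonal entries and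
`v ᵥ* M = 0` for some `v > 0`; these are the only properties of an irreducible singular
`M`-matrix that the argument uses.

The heart of the matter is a minimum principle, `nonneg_or_forall_neg`: if `E ≥ 0` is diagonal and
`(M + E) y ≥ 0`, then `y ≥ 0`, unless `y < 0` in every component and `E = 0`. It follows by
pairing `(M + E) y` with the restriction of `v` to the set where `y` is negative: all terms so
obtained are nonpositive, hence vanish, and irreducibility does the rest. Consequently `M + E` is
nonsingular with nonnegative inverse when `E ≠ 0`, and a nonzero vector in the kernel of `M` is
strictly positive or strictly negative.

Since `A - D(x) = M + (1 - D(x))`, pairing the equation with `v` gives `v ⬝ᵥ (x - |x|) = 0`, so the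
solutions are the nonnegative `x` with `M x = b`. Two of them differ by a kernel vector, so at
most one has a zero component.

For the iteration, pairing `(A - D(x)) y = b` with `v` gives `∑ vᵢ (1 - sign xᵢ) yᵢ = 0`; so
if `x` has a nonpositive component, then `y` has one too, at an index where `x` has one
(`exists_nonpos_of_step`). Hence the iteration never breaks down. By the minimum principle the
iterates increase from the first one on (`step_le_step`), so the sets of nonpositive indices
decrease. If such a set does not shrink in one step, the identity above forces the new iterate
to vanish on it, and it is a solution with a zero component (`isSolution_of_step_of_nonpos`). As
these sets are nonempty with at most `n` elements, this happens within `n` steps after the first.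
-/

namespace AVE

open Finset

variable {n : ℕ}

/-! ### Irreducibility and the minimum principle -/

/-- Irreducibility in terms of index sets instead of permutations. -/
theorem IsIrreducible.eq_univ {M : Matrix (Fin n) (Fin n) ℝ} (hirr : IsIrreducible M)
    {S : Finset (Fin n)} (hS : S.Nonempty) (h0 : ∀ i ∉ S, ∀ j ∈ S, M i j = 0) : S = univ := by
  by_contra hne
  have hlt : #S < n := by
    simpa using Finset.card_lt_card (Finset.ssubset_univ_iff.2 hne)
  refine hirr ?_
  have hcard : Fintype.card {j : Fin n // (j : ℕ) < #S} = Fintype.card {i : Fin n // i ∈ S} := by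
    rw [Fintype.card_coe, Fintype.card_subtype, Fin.card_filter_val_lt, min_eq_right hlt.le]
  let e := Fintype.equivOfCardEq hcard
  refine ⟨e.extendSubtype, #S, hS.card_pos, hlt, fun i j hi hj => ?_⟩
  exact h0 _ (e.extendSubtype_not_mem i (by simpa using hi)) _ (e.extendSubtype_mem j hj)

/-- Minimum principle: `M + E`, with `E ≥ 0` diagonal, is inverse-nonnegative, except that for
`E = 0` the kernel of `M` contains strictly negative vectors. -/
theorem nonneg_or_forall_neg {M : Matrix (Fin n) (Fin n) ℝ} {v : Fin n → ℝ}
    (hM : ∀ i j, i ≠ j → M i j ≤ 0) (hirr : IsIrreducible M) (hv : ∀ i, 0 < v i)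
    (hvM : ∀ j, ∑ i, v i * M i j = 0) {e y : Fin n → ℝ} (he : ∀ i, 0 ≤ e i)
    (hy : ∀ i, 0 ≤ (M *ᵥ y) i + e i * y i) :
    (∀ i, 0 ≤ y i) ∨ ((∀ i, y i < 0) ∧ ∀ i, e i = 0) := by
  by_cases hpos : ∀ i, 0 ≤ y i
  · exact .inl hpos
  right
  push Not at hpos
  set S : Finset (Fin n) := univ.filter fun i => y i < 0 with hSdef
  have memS : ∀ i, i ∈ S ↔ y i < 0 := fun i => by simp [hSdef]
  have hSne : S.Nonempty := hpos.imp fun i hi => (memS i).2 hi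
  have hcompl : ∀ j, ∑ i ∈ S, v i * M i j = -∑ i ∈ Sᶜ, v i * M i j := fun j => by
    rw [eq_neg_iff_add_eq_zero, Finset.sum_add_sum_compl, hvM]
  have hc_in : ∀ i ∉ S, ∀ j ∈ S, v i * M i j ≤ 0 := fun i hi j hj =>
    mul_nonpos_of_nonneg_of_nonpos (hv i).le (hM i j fun h => hi (h ▸ hj))
  have h1 : ∀ j ∈ univ, y j * ∑ i ∈ S, v i * M i j ≤ 0 := fun j _ => by
    by_cases hj : j ∈ S
    · refine mul_nonpos_of_nonpos_of_nonneg ((memS j).1 hj).le ?_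
      rw [hcompl, neg_nonneg]
      exact Finset.sum_nonpos fun i hi => hc_in i (Finset.mem_compl.1 hi) j hj
    · refine mul_nonpos_of_nonneg_of_nonpos (not_lt.1 fun h => hj ((memS j).2 h)) ?_
      exact Finset.sum_nonpos fun i hi =>
        mul_nonpos_of_nonneg_of_nonpos (hv i).le (hM i j fun h => hj (h ▸ hi))
  have h2 : ∀ i ∈ S, v i * (e i * y i) ≤ 0 := fun i hi =>
    mul_nonpos_of_nonneg_of_nonpos (hv i).le
      (mul_nonpos_of_nonneg_of_nonpos (he i) ((memS i).1 hi).le)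
  have hsum : ∑ i ∈ S, v i * ((M *ᵥ y) i + e i * y i)
      = ∑ j, y j * ∑ i ∈ S, v i * M i j + ∑ i ∈ S, v i * (e i * y i) := by
    simp only [mul_add, Finset.sum_add_distrib, Matrix.mulVec, dotProduct, Finset.mul_sum]
    rw [Finset.sum_comm]
    congr 1
    exact Finset.sum_congr rfl fun j _ => Finset.sum_congr rfl fun i _ => by ring
  have hnonneg : 0 ≤ ∑ i ∈ S, v i * ((M *ᵥ y) i + e i * y i) :=
    Finset.sum_nonneg fun i _ => mul_nonneg (hv i).le (hy i)
  have s1 := Finset.sum_nonpos h1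
  have s2 := Finset.sum_nonpos h2
  have z1 := (Finset.sum_eq_zero_iff_of_nonpos h1).1 (by linarith)
  have z2 := (Finset.sum_eq_zero_iff_of_nonpos h2).1 (by linarith)
  have hSuniv : S = univ := hirr.eq_univ hSne fun i hi j hj => by
    have := (mul_eq_zero.1 (z1 j (mem_univ j))).resolve_left ((memS j).1 hj).ne
    rw [hcompl, neg_eq_zero, Finset.sum_eq_zero_iff_of_nonpos
      fun i hi => hc_in i (Finset.mem_compl.1 hi) j hj] at this
    exact (mul_eq_zero.1 (this i (Finset.mem_compl.2 hi))).resolve_left (hv i).ne'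
  have hneg : ∀ i, y i < 0 := fun i => (memS i).1 (hSuniv ▸ mem_univ i)
  refine ⟨hneg, fun i => ?_⟩
  exact (mul_eq_zero.1 ((mul_eq_zero.1 (z2 i (hSuniv ▸ mem_univ i))).resolve_left
    (hv i).ne')).resolve_right (hneg i).ne

/-! ### The matrices `A - D(x)` -/

theorem IsSingularMMatrix.nonpos_of_ne {M : Matrix (Fin n) (Fin n) ℝ} (hM : IsSingularMMatrix M)
    (i j : Fin n) (hij : i ≠ j) : M i j ≤ 0 := by
  obtain ⟨s, B, hB, rfl, -⟩ := hM
  simpa [Matrix.one_apply_ne hij] using hB i j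

theorem sign_mul_self_eq_abs (t : ℝ) : Real.sign t * t = |t| := by
  rcases lt_trichotomy t 0 with h | rfl | h
  · rw [Real.sign_of_neg h, abs_of_neg h, neg_one_mul]
  · simp
  · rw [Real.sign_of_pos h, abs_of_pos h, one_mul]

theorem abs_sign_le_one (t : ℝ) : |Real.sign t| ≤ 1 := by
  rcases Real.sign_apply_eq t with h | h | h <;> simp [h]

theorem one_sub_sign_nonneg (t : ℝ) : 0 ≤ 1 - Real.sign t :=
  sub_nonneg.2 (abs_le.1 (abs_sign_le_one t)).2

theorem one_sub_sign_eq_zero_iff {t : ℝ} : 1 - Real.sign t = 0 ↔ 0 < t := by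
  rcases lt_trichotomy t 0 with h | rfl | h
  · simp only [Real.sign_of_neg h, not_lt.2 h.le, iff_false]; norm_num
  · simp
  · simp [Real.sign_of_pos h, h]

theorem D_ne_one_iff {x : Fin n → ℝ} : D x ≠ 1 ↔ ∃ i, x i ≤ 0 := by
  rw [D, ← Matrix.diagonal_one, Ne, Matrix.diagonal_injective.eq_iff, funext_iff, not_forall]
  refine exists_congr fun i => ?_
  rw [← not_lt, ← one_sub_sign_eq_zero_iff, sub_eq_zero, eq_comm]

theorem sub_D_mulVec_apply (A : Matrix (Fin n) (Fin n) ℝ) (x y : Fin n → ℝ) (i : Fin n) :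
    ((A - D x) *ᵥ y) i = ((A - 1) *ᵥ y) i + (1 - Real.sign (x i)) * y i := by
  simp only [D, Matrix.sub_mulVec, Matrix.one_mulVec, Pi.sub_apply, Matrix.mulVec_diagonal]
  ring

/-- Solving the equation means being a fixed point of the Newton step, without inverting. -/
theorem isSolution_iff {A : Matrix (Fin n) (Fin n) ℝ} {b x : Fin n → ℝ} :
    IsSolution A b x ↔ (A - D x) *ᵥ x = b := by
  have : (fun i => |x i|) = D x *ᵥ x := by
    ext i
    rw [D, Matrix.mulVec_diagonal, sign_mul_self_eq_abs]
  rw [IsSolution, this, Matrix.sub_mulVec]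

theorem dotProduct_mulVec_eq_zero {M : Matrix (Fin n) (Fin n) ℝ} {v : Fin n → ℝ}
    (hvM : ∀ j, ∑ i, v i * M i j = 0) (y : Fin n → ℝ) : v ⬝ᵥ (M *ᵥ y) = 0 := by
  have : v ᵥ* M = 0 := funext hvM
  rw [Matrix.dotProduct_mulVec, this, zero_dotProduct]

/-- The orthogonality relation obtained by pairing a Newton step `(A - D(x)) y = b` with `v`. -/
theorem sum_mul_eq_zero_of_step {A : Matrix (Fin n) (Fin n) ℝ} {b v x y : Fin n → ℝ}
    (hvM : ∀ j, ∑ i, v i * (A - 1) i j = 0) (hvb : v ⬝ᵥ b = 0) (h : (A - D x) *ᵥ y = b) :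
    ∑ i, v i * ((1 - Real.sign (x i)) * y i) = 0 := by
  have h' : b = (A - 1) *ᵥ y + fun i => (1 - Real.sign (x i)) * y i := by
    rw [← h]
    exact funext (sub_D_mulVec_apply A x y)
  rw [h', dotProduct_add, dotProduct_mulVec_eq_zero hvM, zero_add] at hvb
  exact hvb

theorem isUnit_sub_D {A : Matrix (Fin n) (Fin n) ℝ} {v x : Fin n → ℝ}
    (hM : ∀ i j, i ≠ j → (A - 1) i j ≤ 0) (hirr : IsIrreducible (A - 1)) (hv : ∀ i, 0 < v i)
    (hvM : ∀ j, ∑ i, v i * (A - 1) i j = 0) (hx : ∃ i, x i ≤ 0) : IsUnit (A - D x) := by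
  obtain ⟨k, hk⟩ := hx
  have key : ∀ y, (A - D x) *ᵥ y = 0 → ∀ i, 0 ≤ y i := fun y hy =>
    (nonneg_or_forall_neg hM hirr hv hvM (fun i => one_sub_sign_nonneg (x i)) fun i => by
      rw [← sub_D_mulVec_apply, hy, Pi.zero_apply]).resolve_right
      fun h => (one_sub_sign_eq_zero_iff.1 (h.2 k)).not_ge hk
  refine Matrix.mulVec_injective_iff_isUnit.1
    ((injective_iff_map_eq_zero (A - D x).mulVecLin).2 fun y hy => ?_)
  have hy' : (A - D x) *ᵥ y = 0 := hy
  ext i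
  have hneg := key (-y) (by rw [Matrix.mulVec_neg, hy', neg_zero]) i
  exact le_antisymm (neg_nonneg.1 hneg) (key y hy' i)

/-! ### Solutions of the absolute value equation -/

theorem IsSolution.nonneg {A : Matrix (Fin n) (Fin n) ℝ} {b v x : Fin n → ℝ}
    (hv : ∀ i, 0 < v i) (hvM : ∀ j, ∑ i, v i * (A - 1) i j = 0) (hvb : v ⬝ᵥ b = 0)
    (hx : IsSolution A b x) (i : Fin n) : 0 ≤ x i := by
  have h := sum_mul_eq_zero_of_step hvM hvb (isSolution_iff.1 hx)
  simp only [sub_mul, sign_mul_self_eq_abs, one_mul] at h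
  have hle : ∀ i ∈ univ, v i * (x i - |x i|) ≤ 0 := fun i _ =>
    mul_nonpos_of_nonneg_of_nonpos (hv i).le (sub_nonpos.2 (le_abs_self _))
  have h0 := (Finset.sum_eq_zero_iff_of_nonpos hle).1 h i (mem_univ i)
  have := (mul_eq_zero.1 h0).resolve_left (hv i).ne'
  rw [sub_eq_zero.1 this]
  exact abs_nonneg _

theorem IsSolution.sub_one_mulVec {A : Matrix (Fin n) (Fin n) ℝ} {b x : Fin n → ℝ}
    (hx : IsSolution A b x) (h0 : ∀ i, 0 ≤ x i) : (A - 1) *ᵥ x = b := by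
  rw [← hx, Matrix.sub_mulVec, Matrix.one_mulVec]
  simp only [abs_of_nonneg (h0 _)]

theorem IsSolution.eq_of_exists_eq_zero {A : Matrix (Fin n) (Fin n) ℝ} {b v x y : Fin n → ℝ}
    (hM : ∀ i j, i ≠ j → (A - 1) i j ≤ 0) (hirr : IsIrreducible (A - 1)) (hv : ∀ i, 0 < v i)
    (hvM : ∀ j, ∑ i, v i * (A - 1) i j = 0) (hvb : v ⬝ᵥ b = 0)
    (hx : IsSolution A b x) (hx0 : ∃ i, x i = 0) (hy : IsSolution A b y) (hy0 : ∃ i, y i = 0) :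
    x = y := by
  -- By the minimum principle `x - y` is nonnegative or strictly negative; the latter is
  -- impossible where `y` vanishes.
  have key : ∀ {x y : Fin n → ℝ}, IsSolution A b x → IsSolution A b y → (∃ i, y i = 0) →
      ∀ i, 0 ≤ (x - y) i := by
    rintro x y hx hy ⟨k, hk⟩
    have hx' := hx.nonneg hv hvM hvb
    have hdiff : (A - 1) *ᵥ (x - y) = 0 := by
      rw [Matrix.mulVec_sub, hx.sub_one_mulVec hx', hy.sub_one_mulVec (hy.nonneg hv hvM hvb),
        sub_self]
    refine (nonneg_or_forall_neg hM hirr hv hvM (e := 0) (fun _ => le_rfl) fun i => ?_).resolve_right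
      fun h => (h.1 k).not_ge ?_
    · simp [hdiff]
    · simpa [hk] using hx' k
  ext i
  exact le_antisymm (sub_nonneg.1 (key hy hx hx0 i)) (sub_nonneg.1 (key hx hy hy0 i))

/-! ### Newton steps -/

theorem exists_nonpos_of_step {A : Matrix (Fin n) (Fin n) ℝ} {b v x y : Fin n → ℝ}
    (hv : ∀ i, 0 < v i) (hvM : ∀ j, ∑ i, v i * (A - 1) i j = 0) (hvb : v ⬝ᵥ b = 0)
    (hx : ∃ i, x i ≤ 0) (h : (A - D x) *ᵥ y = b) : ∃ i, y i ≤ 0 := by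
  by_contra! hy
  obtain ⟨k, hk⟩ := hx
  have hpos : 0 < 1 - Real.sign (x k) :=
    (one_sub_sign_nonneg _).lt_of_ne' fun h => (one_sub_sign_eq_zero_iff.1 h).not_ge hk
  refine (Finset.sum_pos' (fun i _ => ?_) ⟨k, mem_univ k, ?_⟩).ne'
    (sum_mul_eq_zero_of_step hvM hvb h)
  · exact mul_nonneg (hv i).le (mul_nonneg (one_sub_sign_nonneg _) (hy i).le)
  · exact mul_pos (hv k) (mul_pos hpos (hy k))

/-- The Newton iterates increase from the first one on: the second of two consecutive steps
goes up. -/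
theorem step_le_step {A : Matrix (Fin n) (Fin n) ℝ} {b v x y z : Fin n → ℝ}
    (hM : ∀ i j, i ≠ j → (A - 1) i j ≤ 0) (hirr : IsIrreducible (A - 1)) (hv : ∀ i, 0 < v i)
    (hvM : ∀ j, ∑ i, v i * (A - 1) i j = 0) (hy : ∃ i, y i ≤ 0)
    (hxy : (A - D x) *ᵥ y = b) (hyz : (A - D y) *ᵥ z = b) (i : Fin n) : y i ≤ z i := by
  obtain ⟨k, hk⟩ := hy
  refine sub_nonneg.1 ((nonneg_or_forall_neg hM hirr hv hvM (y := z - y)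
    (fun i => one_sub_sign_nonneg (y i)) fun i => ?_).resolve_right
    (fun h => (one_sub_sign_eq_zero_iff.1 (h.2 k)).not_ge hk) i)
  rw [← sub_D_mulVec_apply, Matrix.mulVec_sub, hyz, Pi.sub_apply, ← hxy, sub_D_mulVec_apply,
    sub_D_mulVec_apply]
  have h1 : Real.sign (x i) * y i ≤ |y i| := by
    refine (le_abs_self _).trans ?_
    rw [abs_mul]
    exact mul_le_of_le_one_left (abs_nonneg _) (abs_sign_le_one _)
  have h2 := sign_mul_self_eq_abs (y i)
  linarith

/-- If a Newton step creates no new positive component, it lands on a solution with a zero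
component. -/
theorem isSolution_of_step_of_nonpos {A : Matrix (Fin n) (Fin n) ℝ} {b v x y : Fin n → ℝ}
    (hv : ∀ i, 0 < v i) (hvM : ∀ j, ∑ i, v i * (A - 1) i j = 0) (hvb : v ⬝ᵥ b = 0)
    (hx : ∃ i, x i ≤ 0) (h : (A - D x) *ᵥ y = b) (hle : ∀ i, x i ≤ y i)
    (hxy : ∀ i, x i ≤ 0 → y i ≤ 0) : IsSolution A b y ∧ ∃ i, y i = 0 := by
  have hterm : ∀ i ∈ univ, v i * ((1 - Real.sign (x i)) * y i) ≤ 0 := fun i _ => by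
    refine mul_nonpos_of_nonneg_of_nonpos (hv i).le ?_
    rcases le_or_gt (x i) 0 with hi | hi
    · exact mul_nonpos_of_nonneg_of_nonpos (one_sub_sign_nonneg _) (hxy i hi)
    · rw [one_sub_sign_eq_zero_iff.2 hi, zero_mul]
  have h0 : ∀ i, (1 - Real.sign (x i)) * y i = 0 := fun i =>
    (mul_eq_zero.1 ((Finset.sum_eq_zero_iff_of_nonpos hterm).1
      (sum_mul_eq_zero_of_step hvM hvb h) i (mem_univ i))).resolve_left (hv i).ne'
  have hyz : ∀ i, x i ≤ 0 → y i = 0 := fun i hi =>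
    (mul_eq_zero.1 (h0 i)).resolve_left fun h => (one_sub_sign_eq_zero_iff.1 h).not_ge hi
  have hnn : ∀ i, 0 ≤ y i := fun i => by
    rcases le_or_gt (x i) 0 with hi | hi
    · exact (hyz i hi).ge
    · exact hi.le.trans (hle i)
  refine ⟨?_, hx.imp hyz⟩
  rw [isSolution_iff, ← h]
  ext i
  rw [sub_D_mulVec_apply, sub_D_mulVec_apply, h0, sub_mul, sign_mul_self_eq_abs,
    abs_of_nonneg (hnn i), one_mul, sub_self]

/-! ### The generalized Newton method -/

theorem gnm_step {A : Matrix (Fin n) (Fin n) ℝ} {b x₀ : Fin n → ℝ} {k : ℕ}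
    (h : IsUnit (A - D (gnm A b x₀ k))) :
    (A - D (gnm A b x₀ k)) *ᵥ gnm A b x₀ (k + 1) = b := by
  rw [gnm, Matrix.mulVec_mulVec, Matrix.mul_nonsing_inv _ ((Matrix.isUnit_iff_isUnit_det _).1 h),
    Matrix.one_mulVec]

theorem gnm_succ_of_isSolution {A : Matrix (Fin n) (Fin n) ℝ} {b x₀ : Fin n → ℝ} {k : ℕ}
    (h : IsUnit (A - D (gnm A b x₀ k))) (hs : IsSolution A b (gnm A b x₀ k)) :
    gnm A b x₀ (k + 1) = gnm A b x₀ k :=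
  Matrix.mulVec_injective_iff_isUnit.2 h ((gnm_step h).trans (isSolution_iff.1 hs).symm)

theorem exists_gnm_nonpos {A : Matrix (Fin n) (Fin n) ℝ} {b v x₀ : Fin n → ℝ}
    (hM : ∀ i j, i ≠ j → (A - 1) i j ≤ 0) (hirr : IsIrreducible (A - 1)) (hv : ∀ i, 0 < v i)
    (hvM : ∀ j, ∑ i, v i * (A - 1) i j = 0) (hvb : v ⬝ᵥ b = 0) (hx₀ : ∃ i, x₀ i ≤ 0) :
    ∀ k, ∃ i, gnm A b x₀ k i ≤ 0
  | 0 => hx₀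
  | k + 1 =>
    have ih := exists_gnm_nonpos hM hirr hv hvM hvb hx₀ k
    exists_nonpos_of_step hv hvM hvb ih (gnm_step (isUnit_sub_D hM hirr hv hvM ih))

/-- The finite termination of the method. -/
theorem exists_gnm_isSolution {A : Matrix (Fin n) (Fin n) ℝ} {b v x₀ : Fin n → ℝ}
    (hM : ∀ i j, i ≠ j → (A - 1) i j ≤ 0) (hirr : IsIrreducible (A - 1)) (hv : ∀ i, 0 < v i)
    (hvM : ∀ j, ∑ i, v i * (A - 1) i j = 0) (hvb : v ⬝ᵥ b = 0) (hx₀ : ∃ i, x₀ i ≤ 0) :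
    ∃ m ≤ n + 1, IsSolution A b (gnm A b x₀ m) ∧ ∃ i, gnm A b x₀ m i = 0 := by
  set x := gnm A b x₀ with hx
  have hnp : ∀ k, ∃ i, x k i ≤ 0 := exists_gnm_nonpos hM hirr hv hvM hvb hx₀
  have hstep : ∀ k, (A - D (x k)) *ᵥ x (k + 1) = b := fun k =>
    gnm_step (isUnit_sub_D hM hirr hv hvM (hnp k))
  have hmono : ∀ k i, x (k + 1) i ≤ x (k + 2) i := fun k =>
    step_le_step hM hirr hv hvM (hnp (k + 1)) (hstep k) (hstep (k + 1))
  by_contra! hno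
  let Z : ℕ → Finset (Fin n) := fun k => univ.filter fun i => x (k + 1) i ≤ 0
  have hlt : ∀ k < n, #(Z (k + 1)) < #(Z k) := fun k hk => by
    refine Finset.card_lt_card (Finset.ssubset_iff_subset_ne.2 ⟨fun i hi => ?_, fun heq => ?_⟩)
    · simp only [Z, mem_filter, mem_univ, true_and] at hi ⊢
      exact (hmono k i).trans hi
    · obtain ⟨hs, i, hi⟩ := isSolution_of_step_of_nonpos hv hvM hvb (hnp (k + 1)) (hstep (k + 1))
        (hmono k) fun i hi => by
          have : i ∈ Z k := by simpa [Z] using hi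
          rw [← heq] at this
          simpa [Z] using this
      exact hno (k + 2) (by omega) hs i hi
  have hcard : ∀ k ≤ n, #(Z k) + k ≤ n := by
    intro k
    induction k with
    | zero => exact fun _ => by simpa using Finset.card_le_univ (Z 0)
    | succ k ih => exact fun hk => by have := ih (by omega); have := hlt k hk; omega
  have hempty : Z n = ∅ := Finset.card_eq_zero.1 (by have := hcard n le_rfl; omega)
  obtain ⟨i, hi⟩ := hnp (n + 1)
  have : i ∈ Z n := by simpa [Z] using hi
  simp [hempty] at this

end AVE

theorem mainTheorem2 (n : ℕ) (hn : 0 < n) (A : Matrix (Fin n) (Fin n) ℝ) (b v : Fin n → ℝ)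
    (hM : AVE.IsSingularMMatrix (A - 1)) (hirr : AVE.IsIrreducible (A - 1))
    (hv : ∀ i, 0 < v i) (hvker : (Aᵀ - 1) *ᵥ v = 0) (hvb : v ⬝ᵥ b = 0) :
    (∀ x : Fin n → ℝ, AVE.IsSolution A b x → ∀ i, 0 ≤ x i) ∧
    ∃ xhat : Fin n → ℝ,
      (AVE.IsSolution A b xhat ∧ ∃ i, xhat i = 0) ∧
      (∀ y : Fin n → ℝ, (AVE.IsSolution A b y ∧ ∃ i, y i = 0) → y = xhat) ∧
      ∀ x₀ : Fin n → ℝ, AVE.D x₀ ≠ 1 →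
        AVE.GnmWellDefined A b x₀ ∧
        ∃ m ≤ n + 1, ∀ k ≥ m, AVE.gnm A b x₀ k = xhat := by
  have hZ := hM.nonpos_of_ne
  have hvM : ∀ j, ∑ i, v i * (A - 1) i j = 0 := by
    have : v ᵥ* (A - 1) = 0 := by
      rw [← Matrix.mulVec_transpose, Matrix.transpose_sub, Matrix.transpose_one, hvker]
    exact fun j => congrFun this j
  -- The solution with a zero component is produced by running the method from the origin.
  obtain ⟨m₀, -, hs, hs0⟩ :=
    AVE.exists_gnm_isSolution (x₀ := 0) hZ hirr hv hvM hvb ⟨⟨0, hn⟩, le_rfl⟩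
  have huniq : ∀ y, AVE.IsSolution A b y → (∃ i, y i = 0) → y = AVE.gnm A b 0 m₀ := fun y hy hy0 =>
    hy.eq_of_exists_eq_zero hZ hirr hv hvM hvb hy0 hs hs0
  refine ⟨fun x hx => hx.nonneg hv hvM hvb, _, ⟨hs, hs0⟩, fun y hy => huniq y hy.1 hy.2,
    fun x₀ hx₀ => ?_⟩
  rw [AVE.D_ne_one_iff] at hx₀
  have hwd : AVE.GnmWellDefined A b x₀ := fun k =>
    AVE.isUnit_sub_D hZ hirr hv hvM (AVE.exists_gnm_nonpos hZ hirr hv hvM hvb hx₀ k)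
  obtain ⟨m, hm, hms, hm0⟩ := AVE.exists_gnm_isSolution hZ hirr hv hvM hvb hx₀
  refine ⟨hwd, m, hm, fun k hk => ?_⟩
  induction k, hk using Nat.le_induction with
  | base => exact huniq _ hms hm0
  | succ k _ ih => rw [AVE.gnm_succ_of_isSolution (hwd k) (ih ▸ hs), ih]
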